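/- Let $[n]=\{1,\dots,n\}$. A family $\mathcal F\subseteq 2^{[n]}$, ordered by inclusion, *contains* a finite poset $P$ (as a weak subposet) if there is an injection $f:P\to\mathcal F$ such that $p\le_P p'$ implies $f(p)\subseteq f(p')$. For a collection $\mathcal P$ of finite posets, let $\mathrm{La}(n,\mathcal P,\#P_2)$ be the maximum, over all families $\mathcal F\subseteq 2^{[n]}$ containing no member of $\mathcal P$, of the number of copies of the two-element chain $P_2$ in $\mathcal F$, i.e. of the number of pairs $A,B\in\mathcal F$ with $A\subsetneq B$. Let $W$ be the poset on five elements $a,b,c,d,e$ whose only strict relations are $b<a$, $b<c$, $d<c$, $d<e$; let $M$ be its dual; and let $\mathcal P_6$ be the collection of all posets on $6$ elements whose undirected Hasse diagram is a path. **Theorem.** There is a function $\varepsilon:\mathbb N\to\mathbb R$ with $\varepsilon(n)\to 0$ as $n\to\infty$ such that, for every integer $n\ge 2$, $$2\binom{n}{\lfloor n/2\rfloor}+1\;\le\;\mathrm{La}(n,\{W,M\},\#P_2)\;\le\;\mathrm{La}(n,\mathcal P_6,\#P_2)\;\le\;(2+\varepsilon(n))\binom{n}{\lfloor n/2\rfloor}.$$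 -/

import Mathlib

/-- A family `F` of subsets of `[n]`, ordered by inclusion, contains the poset `P` as a (weak)
subposet: there is an order-preserving injection from `P` to `F`. -/
def HasSubposet {n : ℕ} (F : Finset (Finset (Fin n))) (P : FinPartOrd.{0}) : Prop :=
  ∃ f : P →o {A : Finset (Fin n) // A ∈ F}, Function.Injective f

/-- `F` is free of every poset of the collection `Ps`. -/
def IsPosetFree {n : ℕ} (F : Finset (Finset (Fin n))) (Ps : Set FinPartOrd.{0}) : Prop :=
  ∀ P ∈ Ps, ¬ HasSubposet F P

/-- A family `G` of subsets of `[n]` is a copy of `Q`: there is an order-preserving bijection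
from `Q` onto `G`. -/
def IsCopy {n : ℕ} (G : Finset (Finset (Fin n))) (Q : FinPartOrd.{0}) : Prop :=
  ∃ f : Q →o {A : Finset (Fin n) // A ∈ G}, Function.Bijective f

open Classical in
/-- The number of copies of `Q` in `F`, that is, of subfamilies of `F` that are copies of `Q`. -/
noncomputable def numCopies {n : ℕ} (F : Finset (Finset (Fin n))) (Q : FinPartOrd.{0}) : ℕ :=
  (F.powerset.filter fun G => IsCopy G Q).card

open Classical in
/-- `La(n, Ps, #Q)`: the maximum number of copies of `Q` in a family of subsets of `[n]` that
contains no poset of `Ps`. -/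
noncomputable def La (n : ℕ) (Ps : Set FinPartOrd.{0}) (Q : FinPartOrd.{0}) : ℕ :=
  (Finset.univ.filter fun F : Finset (Finset (Fin n)) => IsPosetFree F Ps).sup
    fun F => numCopies F Q

/-- The chain `P_k` on `k` elements. -/
abbrev chainPoset (k : ℕ) : FinPartOrd.{0} := FinPartOrd.of (Fin k)

/-- The collection `𝒫_k` of the posets on `k` elements whose undirected Hasse diagram is a path. -/
def pathPosets (k : ℕ) : Set FinPartOrd.{0} :=
  {P | Nonempty (SimpleGraph.hasse P ≃g SimpleGraph.pathGraph k)}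

/-- The five elements of the poset `W`. -/
inductive WElem : Type
  | a | b | c | d | e

/-- The order of `W`: its strict relations are `b < a`, `b < c`, `d < c`, `d < e`. -/
inductive WElem.Le : WElem → WElem → Prop
  | refl (x : WElem) : WElem.Le x x
  | ba : WElem.Le WElem.b WElem.a
  | bc : WElem.Le WElem.b WElem.c
  | dc : WElem.Le WElem.d WElem.c
  | de : WElem.Le WElem.d WElem.e

instance : PartialOrder WElem where
  le := WElem.Le
  le_refl := WElem.Le.refl
  le_trans := by
    intro x y z hxy hyz
    cases hxy <;> cases hyz <;> constructor
  le_antisymm := by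
    intro x y hxy hyx
    cases hxy <;> first | rfl | cases hyx

instance : Finite WElem :=
  Finite.of_injective (β := Fin 5)
    (fun x => match x with | .a => 0 | .b => 1 | .c => 2 | .d => 3 | .e => 4)
    (by intro x y; cases x <;> cases y <;> simp)

noncomputable instance : Fintype WElem := Fintype.ofFinite WElem

/-- The poset `W`. -/
noncomputable abbrev posetW : FinPartOrd.{0} := FinPartOrd.of WElem

/-- The poset `M`, the dual of `W`. -/
noncomputable abbrev posetM : FinPartOrd.{0} := FinPartOrd.of WElemᵒᵈ

/-!
Call two sets comparable if one is a proper subset of the other. A family contains no poset whose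
Hasse diagram is a path on six elements exactly when its comparability graph has no path on six
vertices: a path in the graph, with each step directed upwards or downwards, generates such a poset
(`ZigZag`, `noSixPath_of_isPosetFree`). Everything about the upper bound follows from this.

* By the Erdős–Gallai argument (`NoSixPath.sum_degree_le`) the comparability graph of such a family
  `F` has at most `2 |F|` edges, and its edges are the copies of the two-element chain. So it
  suffices that `|F| ≤ (1 + o(1)) C(n, n/2)`.
* The Erdős–Gallai bound also makes the graph `4`-degenerate. A pair `A ⊂ B` lies on a random full
  chain with probability at most `1 / m` times that of either of its members, if both have size
  between `m` and `n - m`; charging every pair to the end deleted first, the expected number of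
  pairs of members on the chain is at most `4 / m` times the expected number of members
  (`NoSixPath.sum_cost_le`). A chain with `X` members has at least `X - 1` pairs, so the expected
  number of members is at most `1 / (1 - 4 / m)`, while each member contributes at least
  `1 / C(n, n/2)` to it (`card_mul_le_of_noSixPath`). Full chains are represented by numberings of
  the ground set, whose prefixes are the members of the chain.
* For fixed `m` the sets outside these sizes are only polynomially many in `n`.

The middle level together with `∅` and `[n]` gives the lower bound, and the middle inequality holds
because six elements, each comparable with the next, always contain a copy of `W` or of `M`
(`exists_isFence`).
-/

/-! ### Graphs without a path on six vertices -/

/-- The list `l` is a path of the graph `r` all of whose vertices lie in `S`. -/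
def IsPathIn {α : Type*} (r : α → α → Prop) (S : Finset α) (l : List α) : Prop :=
  l.Nodup ∧ l.IsChain r ∧ ∀ x ∈ l, x ∈ S

/-- The graph `r` restricted to `S` has no path on six vertices. -/
def NoSixPath {α : Type*} (r : α → α → Prop) (S : Finset α) : Prop :=
  ∀ l : List α, IsPathIn r S l → l.length ≠ 6

section Graph

variable {α : Type*} {r : α → α → Prop} {S T : Finset α}

theorem NoSixPath.mono (h : NoSixPath r S) (hT : T ⊆ S) : NoSixPath r T :=
  fun l hl => h l ⟨hl.1, hl.2.1, fun x hx => hT (hl.2.2 x hx)⟩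

theorem NoSixPath.length_le (h : NoSixPath r S) {l : List α} (hl : IsPathIn r S l) :
    l.length ≤ 5 := by
  by_contra hlt
  refine h (l.take 6) ⟨hl.1.sublist (List.take_sublist 6 l), hl.2.1.take 6,
    fun x hx => hl.2.2 x (List.mem_of_mem_take hx)⟩ ?_
  simp; omega

theorem NoSixPath.exists_longest (h : NoSixPath r S) :
    ∃ l, IsPathIn r S l ∧ ∀ l', IsPathIn r S l' → l'.length ≤ l.length := by
  classical
  let P : ℕ → Prop := fun k => ∃ l, IsPathIn r S l ∧ l.length = k
  have h0 : P 0 := ⟨[], by simp [IsPathIn], rfl⟩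
  obtain ⟨l, hl, hk⟩ := Nat.findGreatest_spec (P := P) (Nat.zero_le 5) h0
  exact ⟨l, hl, fun l' hl' => hk ▸ Nat.le_findGreatest (h.length_le hl') ⟨l', hl', rfl⟩⟩

/-- A cycle on as many vertices as a longest path receives no edge from outside: such an edge
followed by the cycle would be a longer path. -/
theorem mem_of_cycle (hsymm : ∀ x y, r x y → r y x) {l : List α} (hp : IsPathIn r S l)
    (hmax : ∀ l', IsPathIn r S l' → l'.length ≤ l.length)
    (hc : ∀ x ∈ l.getLast?, ∀ y ∈ l.head?, r x y) {x y : α} (hx : x ∈ l) (hy : y ∈ S)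
    (hxy : r x y) : y ∈ l := by
  by_contra hn
  obtain ⟨s, t, rfl⟩ := List.append_of_mem hx
  obtain ⟨h1, h2, h3⟩ := hp
  have hperm : (x :: t ++ s).Perm (s ++ x :: t) := List.perm_append_comm
  have hchain : (x :: t ++ s).IsChain r := by
    rw [List.isChain_append] at h2 ⊢
    refine ⟨h2.2.1, h2.1, fun u hu v hv => hc u ?_ v ?_⟩
    · rw [Option.mem_def] at hu ⊢
      simp [List.getLast?_append, hu]
    · rw [Option.mem_def] at hv ⊢
      simp [List.head?_append, hv]
  have := hmax (y :: (x :: t ++ s)) ⟨List.nodup_cons.2 ⟨fun h => hn (hperm.mem_iff.1 h),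
    hperm.nodup_iff.2 h1⟩, ?_, ?_⟩
  · simp only [List.length_cons, hperm.length_eq] at this
    omega
  · refine List.isChain_cons.2 ⟨?_, hchain⟩
    simpa using hsymm _ _ hxy
  · intro z hz
    rcases List.mem_cons.1 hz with rfl | hz
    · exact hy
    · exact h3 z (hperm.mem_iff.1 hz)

variable [DecidableEq α] [DecidableRel r]

/-- If a path on six vertices is missing, then some vertex has degree at most two, or some
nonempty set of at most five vertices is a union of connected components: the vertices of a
longest path, which the neighbours of its two ends turn into a cycle. -/
theorem NoSixPath.exists_reducible (hsymm : ∀ x y, r x y → r y x) (hirr : ∀ x, ¬ r x x)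
    (h : NoSixPath r S) (hS : S.Nonempty) :
    (∃ x ∈ S, (S.filter (r x)).card ≤ 2) ∨
      ∃ T ⊆ S, T.Nonempty ∧ T.card ≤ 5 ∧ ∀ x ∈ T, ∀ y ∈ S, r x y → y ∈ T := by
  by_contra! hcon
  obtain ⟨hdeg, hclosed⟩ := hcon
  obtain ⟨l, hl, hmax⟩ := h.exists_longest
  have hlen := h.length_le hl
  have hncyc : ∀ l', IsPathIn r S l' → l'.length = l.length → l' ≠ [] →
      ¬ ∀ x ∈ l'.getLast?, ∀ y ∈ l'.head?, r x y := by
    intro l' hl' hll hne hc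
    obtain ⟨x, hx, y, hy, hxy, hyn⟩ := hclosed l'.toFinset
      (fun x hx => hl'.2.2 x (by simpa using hx)) (by simpa using hne)
      ((List.toFinset_card_le l').trans (by omega))
    exact hyn (List.mem_toFinset.2 (mem_of_cycle hsymm hl' (hll ▸ hmax) hc
      (List.mem_toFinset.1 hx) hy hxy))
  -- the neighbours of the first vertex of a longest path lie on that path
  have hhead : ∀ a t, IsPathIn r S (a :: t) → (a :: t).length = l.length →
      S.filter (r a) ⊆ t.toFinset := by
    intro a t hat hlat y hy
    rw [Finset.mem_filter] at hy
    by_contra hyt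
    have hya : y ≠ a := fun h => hirr a (h ▸ hy.2)
    have := hmax (y :: a :: t) ⟨List.nodup_cons.2 ⟨by simp_all, hat.1⟩,
      List.isChain_cons_cons.2 ⟨hsymm _ _ hy.2, hat.2.1⟩, by
        intro z hz
        rcases List.mem_cons.1 hz with rfl | hz
        exacts [hy.1, hat.2.2 z hz]⟩
    simp only [List.length_cons] at this hlat
    omega
  have hthree : ∀ a t, IsPathIn r S (a :: t) → (a :: t).length = l.length →
      3 ≤ (t.filter (r a)).length := by
    intro a t hat hlat
    refine (hdeg a (hat.2.2 a (by simp))).trans_le ((Finset.card_le_card fun y hy => ?_).trans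
      (List.toFinset_card_le _))
    have hyt := hhead a t hat hlat hy
    simp_all
  match l, hl, hmax, hlen, hncyc, hhead, hthree with
  | [], _, hmax, _, _, _, _ =>
    obtain ⟨x, hx⟩ := hS
    simpa using hmax [x] (by simp [IsPathIn, hx])
  | [a], hl, _, _, _, _, hthree => simpa using hthree a [] hl rfl
  | [a, b], hl, _, _, _, _, hthree =>
    have := hthree a [b] hl rfl
    have := this.trans (List.length_filter_le _ _)
    simp at this
  | [a, b, c], hl, _, _, _, _, hthree =>
    have := hthree a [b, c] hl rfl
    have := this.trans (List.length_filter_le _ _)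
    simp at this
  | [a, b, c, d], hl, _, _, hncyc, _, hthree =>
    have h3 := hthree a [b, c, d] hl rfl
    refine hncyc _ hl rfl (by simp) ?_
    simp only [List.filter_cons, List.filter_nil] at h3
    simp
    grind
  | [a, b, c, d, e], hl, _, _, hncyc, _, hthree =>
    have hl' : IsPathIn r S [e, d, c, b, a] := by
      simp only [IsPathIn, List.isChain_cons_cons, List.nodup_cons, List.mem_cons] at hl ⊢
      grind
    have h3 := hthree a [b, c, d, e] hl rfl
    have h3' := hthree e [d, c, b, a] hl' rfl
    simp only [List.filter_cons, List.filter_nil] at h3 h3'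
    by_cases hea : r e a
    · exact hncyc _ hl rfl (by simp) (by simpa using hea)
    have hae : ¬ r a e := fun h => hea (hsymm _ _ h)
    have hac : r a c := by grind
    have heb : r e b := by grind
    refine hncyc [c, d, e, b, a] ?_ rfl (by simp) (by simpa using hac)
    simp only [IsPathIn, List.isChain_cons_cons, List.nodup_cons, List.mem_cons] at hl ⊢
    grind
  | _ :: _ :: _ :: _ :: _ :: _ :: _, _, _, hlen, _, _, _ => simp at hlen; omega

/-- The Erdős–Gallai bound for a path on six vertices, as a bound on the sum of the degrees. -/
theorem NoSixPath.sum_degree_le (hsymm : ∀ x y, r x y → r y x) (hirr : ∀ x, ¬ r x x)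
    (h : NoSixPath r S) : ∑ x ∈ S, (S.filter (r x)).card ≤ 4 * S.card := by
  induction S using Finset.strongInduction with
  | H S ih =>
  rcases S.eq_empty_or_nonempty with rfl | hS
  · simp
  rcases h.exists_reducible hsymm hirr hS with ⟨v, hv, hdeg⟩ | ⟨T, hTS, hT, hcard, hclosed⟩
  · have hih := ih (S.erase v) (Finset.erase_ssubset hv) (h.mono (Finset.erase_subset _ _))
    have hsplit : ∀ x, (S.filter (r x)).card =
        ((S.erase v).filter (r x)).card + if r x v then 1 else 0 := by
      intro x
      conv_lhs => rw [← Finset.insert_erase hv, Finset.filter_insert]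
      split_ifs
      · rw [Finset.card_insert_of_notMem (by simp)]
      · rfl
    have hback : ∑ x ∈ S.erase v, (if r x v then 1 else 0) ≤ (S.filter (r v)).card := by
      rw [← Finset.card_filter]
      refine Finset.card_le_card fun x hx => ?_
      simp only [Finset.mem_filter, Finset.mem_erase] at hx ⊢
      exact ⟨hx.1.2, hsymm _ _ hx.2⟩
    rw [← Finset.add_sum_erase S _ hv, Finset.sum_congr rfl fun x _ => hsplit x,
      Finset.sum_add_distrib]
    have := Finset.card_erase_add_one hv
    omega
  · have hih := ih (S \ T) (Finset.sdiff_ssubset hTS hT) (h.mono Finset.sdiff_subset)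
    have hout : ∀ x ∈ S \ T, (S.filter (r x)).card = ((S \ T).filter (r x)).card := by
      intro x hx
      congr 1
      ext y
      simp only [Finset.mem_filter, Finset.mem_sdiff] at hx ⊢
      exact ⟨fun hy => ⟨⟨hy.1, fun hyT => hx.2 (hclosed y hyT x hx.1 (hsymm _ _ hy.2))⟩, hy.2⟩,
        fun hy => ⟨hy.1.1, hy.2⟩⟩
    have hin : ∀ x ∈ T, (S.filter (r x)).card ≤ 4 := by
      intro x hx
      have : S.filter (r x) ⊆ T.erase x := fun y hy => by
        rw [Finset.mem_filter] at hy
        exact Finset.mem_erase.2 ⟨fun h => hirr x (h ▸ hy.2), hclosed x hx y hy.1 hy.2⟩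
      have := Finset.card_le_card this
      rw [Finset.card_erase_of_mem hx] at this
      omega
    rw [← Finset.sum_sdiff hTS, Finset.sum_congr rfl hout]
    have h4 := Finset.sum_le_card_nsmul T _ 4 hin
    have := Finset.card_sdiff_add_card_eq_card hTS
    rw [smul_eq_mul] at h4
    omega

/-- If every edge costs at most the weight of either of its ends, all edges together cost at most
four times the total weight: by `NoSixPath.sum_degree_le` the graph is `4`-degenerate, and each
edge is charged to the end that is deleted first. Edges are counted in both directions. -/
theorem NoSixPath.sum_cost_le (hsymm : ∀ x y, r x y → r y x) (hirr : ∀ x, ¬ r x x)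
    (h : NoSixPath r S) (w : α → ℕ) (c : α → α → ℕ) (hc : ∀ x y, c x y = c y x)
    (hw : ∀ x ∈ S, ∀ y ∈ S, r x y → c x y ≤ w x) :
    ∑ x ∈ S, ∑ y ∈ S with r x y, c x y ≤ 8 * ∑ x ∈ S, w x := by
  induction S using Finset.strongInduction with
  | H S ih =>
  rcases S.eq_empty_or_nonempty with rfl | hS
  · simp
  obtain ⟨v, hv, hdeg⟩ : ∃ v ∈ S, (S.filter (r v)).card ≤ 4 :=
    Finset.exists_le_of_sum_le hS (by
      simpa [mul_comm] using h.sum_degree_le hsymm hirr)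
  have hih := ih (S.erase v) (Finset.erase_ssubset hv) (h.mono (Finset.erase_subset _ _))
    fun x hx y hy => hw x (Finset.mem_of_mem_erase hx) y (Finset.mem_of_mem_erase hy)
  have hsplit : ∀ x, ∑ y ∈ S with r x y, c x y =
      ∑ y ∈ S.erase v with r x y, c x y + if r x v then c x v else 0 := by
    intro x
    rw [Finset.sum_filter, Finset.sum_filter, Finset.sum_erase_add S _ hv]
  have hdegw : ∑ y ∈ S with r v y, c v y ≤ 4 * w v := by
    refine (Finset.sum_le_card_nsmul _ _ (w v) fun y hy => ?_).trans
      (Nat.mul_le_mul_right _ hdeg)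
    rw [Finset.mem_filter] at hy
    exact hw v hv y hy.1 hy.2
  have hback : ∑ x ∈ S.erase v, (if r x v then c x v else 0) ≤ ∑ y ∈ S with r v y, c v y := by
    rw [← Finset.sum_filter]
    refine (Finset.sum_congr rfl fun x _ => hc x v).trans_le
      (Finset.sum_le_sum_of_subset fun x hx => ?_)
    simp only [Finset.mem_filter, Finset.mem_erase] at hx ⊢
    exact ⟨hx.1.2, hsymm _ _ hx.2⟩
  rw [← Finset.add_sum_erase S _ hv, Finset.sum_congr rfl fun x _ => hsplit x,
    Finset.sum_add_distrib, ← Finset.add_sum_erase S w hv]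
  omega

end Graph

/-! ### Members of a family on a random full chain -/

theorem le_choose_of_pos_of_lt {a b : ℕ} (ha : 0 < a) (hab : a < b) : b ≤ b.choose a := by
  induction b with
  | zero => omega
  | succ b ih =>
    obtain ⟨a, rfl⟩ : ∃ k, a = k + 1 := ⟨a - 1, by omega⟩
    rcases (Nat.lt_succ_iff.1 hab).eq_or_lt with h | h
    · rw [← h]
      simp
    · have h1 := ih (by omega)
      have h2 : 0 < b.choose a := Nat.choose_pos (by omega)
      rw [Nat.choose_succ_succ']
      omega

namespace Numbering

open Finset Nat

variable {X : Type*} [Fintype X] [DecidableEq X] {s t : Finset X}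

/-- A numbering with prefixes `s ⊆ t` consists of a numbering of `t` with prefix `s` and of a
numbering of the complement of `t`. -/
theorem card_prefixed_inter_le (hst : s ⊆ t) :
    #(prefixed s ∩ prefixed t) ≤ (#s)! * (#t - #s)! * (Fintype.card X - #t)! := by
  have hs : #(s.subtype (· ∈ t)) = #s := by
    rw [card_subtype, filter_true_of_mem hst]
  have hcard : #(prefixed (s.subtype (· ∈ t)) ×ˢ (univ : Finset (Numbering ↑(tᶜ)))) =
      (#s)! * (#t - #s)! * (Fintype.card X - #t)! := by
    rw [card_product, card_prefixed, hs, Finset.card_univ, Fintype.card_numbering]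
    simp
  rw [← hcard]
  refine card_le_card_of_surjOn (fun p => ((prefixedEquiv t).symm p).1) fun f hf => ?_
  simp only [coe_inter, Set.mem_inter_iff, mem_coe, mem_prefixed] at hf
  refine ⟨prefixedEquiv t ⟨f, mem_prefixed.2 hf.2⟩, ?_, by simp⟩
  simp only [coe_product, Set.mem_prod, mem_coe, mem_prefixed, mem_univ, and_true]
  intro x
  rw [hs, mem_subtype, hf.1 x]
  rfl

theorem card_mul_card_prefixed_inter_le (hs : s.Nonempty) (hst : s ⊂ t) :
    #t * #(prefixed s ∩ prefixed t) ≤ #(prefixed t) := by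
  have hlt := card_lt_card hst
  calc #t * #(prefixed s ∩ prefixed t)
      ≤ (#t).choose #s * ((#s)! * (#t - #s)! * (Fintype.card X - #t)!) :=
        Nat.mul_le_mul (le_choose_of_pos_of_lt hs.card_pos hlt)
          (card_prefixed_inter_le hst.subset)
    _ = #(prefixed t) := by
        rw [card_prefixed, ← Nat.choose_mul_factorial_mul_factorial hlt.le]
        ring

theorem card_compl_mul_card_prefixed_inter_le (ht : t ≠ univ) (hst : s ⊂ t) :
    (Fintype.card X - #s) * #(prefixed s ∩ prefixed t) ≤ #(prefixed s) := by
  have hlt := card_lt_card hst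
  have hlt' : #t < Fintype.card X := by
    rw [← Finset.card_univ]
    exact card_lt_card (ssubset_univ_iff.2 ht)
  have hsub : Fintype.card X - #s - (#t - #s) = Fintype.card X - #t := by omega
  have := Nat.choose_mul_factorial_mul_factorial
    (show #t - #s ≤ Fintype.card X - #s by omega)
  rw [hsub] at this
  calc (Fintype.card X - #s) * #(prefixed s ∩ prefixed t)
      ≤ (Fintype.card X - #s).choose (#t - #s) *
          ((#s)! * (#t - #s)! * (Fintype.card X - #t)!) :=
        Nat.mul_le_mul (le_choose_of_pos_of_lt (by omega) (by omega))
          (card_prefixed_inter_le hst.subset)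
    _ = #(prefixed s) := by
        rw [card_prefixed, ← this]
        ring

/-- The prefixes of a numbering form a chain, and a chain with `k` members has at least `k - 1`
comparable pairs. -/
theorem card_filter_isPrefix_le (F : Finset (Finset X)) (f : Numbering X) :
    #{s ∈ F | IsPrefix f s} ≤
      1 + #{p ∈ F ×ˢ F | p.1 ⊂ p.2 ∧ IsPrefix f p.1 ∧ IsPrefix f p.2} := by
  rcases (F.filter (IsPrefix f)).eq_empty_or_nonempty with h | h
  · simp [h]
  obtain ⟨m, hm, hmin⟩ := exists_min_image _ card h
  rw [← card_erase_add_one hm, add_comm]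
  gcongr
  refine card_le_card_of_injOn (fun s => (m, s)) (fun s hs => ?_)
    fun _ _ _ _ h => (Prod.mk.inj h).2
  have hs' := mem_of_mem_erase hs
  have hms := hmin s hs'
  simp only [mem_coe, mem_filter, mem_product, mem_erase] at hs hm ⊢
  exact ⟨⟨hm.1, hs.2.1⟩,
    (hm.2.subset_of_card_le_card hs.2.2 hms).ssubset_of_ne (Ne.symm hs.1), hm.2, hs.2.2⟩

theorem sum_card_prefixed_le (F : Finset (Finset X)) :
    ∑ s ∈ F, #(prefixed s) ≤ (Fintype.card X)! +
      ∑ p ∈ F ×ˢ F with p.1 ⊂ p.2, #(prefixed p.1 ∩ prefixed p.2) := by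
  have h1 : ∑ s ∈ F, #(prefixed s) = ∑ f : Numbering X, #{s ∈ F | IsPrefix f s} := by
    simp only [prefixed]
    exact sum_card_bipartiteAbove_eq_sum_card_bipartiteBelow (fun s f => IsPrefix f s)
  have h2 : ∑ p ∈ F ×ˢ F with p.1 ⊂ p.2, #(prefixed p.1 ∩ prefixed p.2) =
      ∑ f : Numbering X,
        #{p ∈ F ×ˢ F | p.1 ⊂ p.2 ∧ IsPrefix f p.1 ∧ IsPrefix f p.2} := by
    simp only [prefixed, ← filter_and]
    simp only [← filter_filter (fun p : Finset X × Finset X => p.1 ⊂ p.2)]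
    exact sum_card_bipartiteAbove_eq_sum_card_bipartiteBelow
      (fun (p : Finset X × Finset X) f => IsPrefix f p.1 ∧ IsPrefix f p.2)
  have h3 : (Fintype.card X)! = ∑ _f : Numbering X, 1 := by
    rw [← card_eq_sum_ones, Finset.card_univ, Fintype.card_numbering]
  rw [h1, h2, h3, ← sum_add_distrib]
  exact sum_le_sum fun f _ => card_filter_isPrefix_le F f

theorem factorial_le_choose_mul_card_prefixed (s : Finset X) :
    (Fintype.card X)! ≤ (Fintype.card X).choose (Fintype.card X / 2) * #(prefixed s) := by
  rw [card_prefixed, ← Nat.choose_mul_factorial_mul_factorial (card_le_univ s), mul_assoc]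
  exact Nat.mul_le_mul_right _ (Nat.choose_le_middle _ _)

end Numbering

/-- Two sets are comparable if one of them is a proper subset of the other. -/
def SetComparable {X : Type*} (s t : Finset X) : Prop := s ⊂ t ∨ t ⊂ s

instance {X : Type*} [DecidableEq X] : DecidableRel (SetComparable (X := X)) :=
  fun _ _ => inferInstanceAs (Decidable (_ ∨ _))

theorem SetComparable.symm {X : Type*} (s t : Finset X) :
    SetComparable s t → SetComparable t s := Or.symm

theorem SetComparable.irrefl {X : Type*} (s : Finset X) : ¬ SetComparable s s := by
  simp [SetComparable]

/-- Both directions of a comparable pair are counted on the left. -/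
theorem sum_setComparable {X : Type*} [DecidableEq X] (F : Finset (Finset X))
    (c : Finset X → Finset X → ℕ) (hc : ∀ s t, c s t = c t s) :
    ∑ s ∈ F, ∑ t ∈ F with SetComparable s t, c s t =
      2 * ∑ p ∈ F ×ˢ F with p.1 ⊂ p.2, c p.1 p.2 := by
  have h1 : ∀ s t, (if SetComparable s t then c s t else 0) =
      (if s ⊂ t then c s t else 0) + if t ⊂ s then c t s else 0 := by
    intro s t
    have : s ⊂ t → ¬ t ⊂ s := fun h h' => h.asymm h'
    rw [hc t s]
    by_cases h : s ⊂ t <;> by_cases h' : t ⊂ s <;> simp_all [SetComparable]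
  have h2 : ∑ s ∈ F, ∑ t ∈ F, (if t ⊂ s then c t s else 0) =
      ∑ s ∈ F, ∑ t ∈ F, (if s ⊂ t then c s t else 0) := Finset.sum_comm
  simp only [Finset.sum_filter, h1, Finset.sum_add_distrib, h2, Finset.sum_product]
  ring

open Finset Numbering in
/-- In a family without six-vertex paths of comparable sets, the pairs of members on a random full
chain are rare, provided that all members have size between `m` and `n - m`; so the expected number
of members on the chain is hardly more than one. -/
theorem card_mul_le_of_noSixPath {X : Type*} [Fintype X] [DecidableEq X]
    (F : Finset (Finset X)) (hF : NoSixPath SetComparable F) {m : ℕ} (hm : 0 < m)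
    (hlo : ∀ s ∈ F, m ≤ #s) (hhi : ∀ s ∈ F, m + #s ≤ Fintype.card X) :
    m * #F ≤ m * (Fintype.card X).choose (Fintype.card X / 2) + 4 * #F := by
  have hcost := hF.sum_cost_le SetComparable.symm SetComparable.irrefl
    (fun s => #(prefixed s)) (fun s t => m * #(prefixed s ∩ prefixed t))
    (fun s t => by rw [inter_comm]) (fun s hs t ht hst => by
      rcases hst with hst | hst
      · have htu : t ≠ univ := by
          rintro rfl
          have := hhi _ ht
          rw [Finset.card_univ] at this
          omega
        have := hhi s hs
        exact (Nat.mul_le_mul_right _ (by omega)).trans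
          (card_compl_mul_card_prefixed_inter_le htu hst)
      · have htn : t.Nonempty := card_pos.1 (hm.trans_le (hlo t ht))
        rw [inter_comm]
        exact (Nat.mul_le_mul_right _ (hlo s hs)).trans
          (card_mul_card_prefixed_inter_le htn hst))
  rw [sum_setComparable F _ (fun s t => by rw [inter_comm]), ← mul_sum] at hcost
  have hsum := sum_card_prefixed_le F
  have hF' : #F * (Fintype.card X).factorial ≤
      (Fintype.card X).choose (Fintype.card X / 2) * ∑ s ∈ F, #(prefixed s) := by
    rw [mul_sum, ← smul_eq_mul]
    exact card_nsmul_le_sum _ _ _ fun s _ => factorial_le_choose_mul_card_prefixed s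
  generalize ∑ p ∈ F ×ˢ F with p.1 ⊂ p.2, #(prefixed p.1 ∩ prefixed p.2) = P at hcost hsum
  generalize ∑ s ∈ F, #(prefixed s) = W at hcost hsum hF'
  generalize (Fintype.card X).choose (Fintype.card X / 2) = C at hF' ⊢
  have hpos := Nat.factorial_pos (Fintype.card X)
  generalize (Fintype.card X).factorial = N at hsum hF' hpos
  rcases le_total m 4 with h4 | h4
  · exact (Nat.mul_le_mul_right _ h4).trans (Nat.le_add_left _ _)
  obtain ⟨k, rfl⟩ := Nat.exists_eq_add_of_le h4
  have hW : k * W ≤ (4 + k) * N := by nlinarith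
  have : k * #F * N ≤ (4 + k) * C * N := by
    calc k * #F * N = k * (#F * N) := by ring
      _ ≤ k * (C * W) := Nat.mul_le_mul_left _ hF'
      _ = C * (k * W) := by ring
      _ ≤ C * ((4 + k) * N) := Nat.mul_le_mul_left _ hW
      _ = (4 + k) * C * N := by ring
  have := Nat.le_of_mul_le_mul_right this hpos
  linarith

open Finset

/-! ### Posets whose Hasse diagram is a path -/

/-- The elements `x 1 < x 0`, `x 1 < x 2`, `x 3 < x 2`, `x 3 < x 4` of a copy of `W`, for an
arbitrary relation `r` in place of `<`; for the relation `>` this is a copy of `M`. -/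
def IsFence {α : Type*} (r : α → α → Prop) (x : Fin 5 → α) : Prop :=
  Function.Injective x ∧ r (x 1) (x 0) ∧ r (x 1) (x 2) ∧ r (x 3) (x 2) ∧ r (x 3) (x 4)

/-- Up to reversing the relation the first step goes down. Each further case names the positions on
the path that form a copy of `W` (left) or of `M` (right). -/
theorem exists_isFence_of_first_step {α : Type*} {r : α → α → Prop}
    (htrans : ∀ x y z, r x y → r y z → r x z) {x : Fin 6 → α} (hx : Function.Injective x)
    (h0 : r (x 1) (x 0)) (h1 : r (x 1) (x 2) ∨ r (x 2) (x 1)) (h2 : r (x 2) (x 3) ∨ r (x 3) (x 2))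
    (h3 : r (x 3) (x 4) ∨ r (x 4) (x 3)) (h4 : r (x 4) (x 5) ∨ r (x 5) (x 4)) :
    ∃ y, IsFence r y ∨ IsFence (flip r) y := by
  have key : ∀ i : Fin 5 → Fin 6, Function.Injective i →
      (r (x (i 1)) (x (i 0)) ∧ r (x (i 1)) (x (i 2)) ∧ r (x (i 3)) (x (i 2)) ∧
        r (x (i 3)) (x (i 4))) ∨
      (r (x (i 0)) (x (i 1)) ∧ r (x (i 2)) (x (i 1)) ∧ r (x (i 2)) (x (i 3)) ∧
        r (x (i 4)) (x (i 3))) → ∃ y, IsFence r y ∨ IsFence (flip r) y :=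
    fun i hi h => ⟨x ∘ i, h.imp (fun h => ⟨hx.comp hi, h⟩) (fun h => ⟨hx.comp hi, h⟩)⟩
  rcases h1 with h1 | h1 <;> rcases h2 with h2 | h2 <;> rcases h3 with h3 | h3
  · exact key ![0, 1, 3, 2, 4] (by decide)
      (Or.inl ⟨h0, htrans _ _ _ h1 h2, h2, htrans _ _ _ h2 h3⟩)
  · rcases h4 with h4 | h4
    · exact key ![0, 1, 3, 4, 5] (by decide) (Or.inl ⟨h0, htrans _ _ _ h1 h2, h3, h4⟩)
    · exact key ![0, 1, 3, 5, 4] (by decide)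
        (Or.inl ⟨h0, htrans _ _ _ h1 h2, htrans _ _ _ h4 h3, h4⟩)
  · exact key ![0, 1, 2, 3, 4] (by decide) (Or.inl ⟨h0, h1, h2, h3⟩)
  · exact key ![0, 1, 2, 4, 3] (by decide) (Or.inl ⟨h0, h1, htrans _ _ _ h3 h2, h3⟩)
  · exact key ![1, 0, 2, 4, 3] (by decide) (Or.inr ⟨h0, htrans _ _ _ h1 h0,
      htrans _ _ _ h2 h3, h3⟩)
  · exact key ![1, 0, 2, 3, 4] (by decide) (Or.inr ⟨h0, htrans _ _ _ h1 h0, h2, h3⟩)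
  · exact key ![0, 2, 1, 3, 4] (by decide) (Or.inl ⟨htrans _ _ _ h1 h0, h1,
      htrans _ _ _ h2 h1, h3⟩)
  · exact key ![0, 2, 1, 4, 3] (by decide) (Or.inl ⟨htrans _ _ _ h1 h0, h1,
      htrans _ _ _ (htrans _ _ _ h3 h2) h1, h3⟩)

/-- Six elements, each comparable with the next, contain a copy of `W` or of `M`. -/
theorem exists_isFence {α : Type*} [PartialOrder α] {x : Fin 6 → α} (hx : Function.Injective x)
    (h : ∀ i : Fin 5, x i.castSucc < x i.succ ∨ x i.succ < x i.castSucc) :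
    ∃ y : Fin 5 → α, IsFence (· < ·) y ∨ IsFence (· > ·) y := by
  rcases h 0 with h0 | h0
  · obtain ⟨y, hy⟩ := exists_isFence_of_first_step (r := fun a b : α => b < a)
      (fun _ _ _ h h' => h'.trans h) hx h0 (h 1).symm (h 2).symm (h 3).symm (h 4).symm
    exact ⟨y, hy.symm⟩
  · exact exists_isFence_of_first_step (r := fun a b : α => a < b)
      (fun _ _ _ h h' => h.trans h') hx h0 (h 1) (h 2) (h 3) (h 4)

/-- The positions of the elements of `W` along its Hasse diagram. -/
def WElem.idx : WElem → Fin 5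
  | .a => 0 | .b => 1 | .c => 2 | .d => 3 | .e => 4

theorem WElem.idx_injective : Function.Injective WElem.idx := by
  intro x y
  cases x <;> cases y <;> simp [WElem.idx]

section Family

variable {n : ℕ} {F : Finset (Finset (Fin n))}

theorem hasSubposet_W_of_isFence {y : Fin 5 → {A : Finset (Fin n) // A ∈ F}}
    (hy : IsFence (· < ·) y) : HasSubposet F posetW := by
  refine ⟨⟨fun w : WElem => y w.idx, fun u v huv => ?_⟩,
    fun u v huv => WElem.idx_injective (hy.1 huv)⟩
  obtain ⟨-, h1, h2, h3, h4⟩ := hy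
  have huv : WElem.Le u v := huv
  cases huv
  exacts [le_rfl, h1.le, h2.le, h3.le, h4.le]

theorem hasSubposet_M_of_isFence {y : Fin 5 → {A : Finset (Fin n) // A ∈ F}}
    (hy : IsFence (· > ·) y) : HasSubposet F posetM := by
  refine ⟨⟨fun w : WElemᵒᵈ => y (OrderDual.ofDual w).idx, fun u v huv => ?_⟩,
    fun u v huv => OrderDual.ofDual.injective (WElem.idx_injective (hy.1 huv))⟩
  obtain ⟨-, h1, h2, h3, h4⟩ := hy
  have key : ∀ u v : WElem, WElem.Le u v → y v.idx ≤ y u.idx := by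
    intro u v h
    cases h
    exacts [le_rfl, h1.le, h2.le, h3.le, h4.le]
  exact key _ _ huv

theorem isPosetFree_pathPosets_of_isPosetFree_W_M (hF : IsPosetFree F {posetW, posetM}) :
    IsPosetFree F (pathPosets 6) := by
  rintro P ⟨φ⟩ ⟨f, hf⟩
  obtain ⟨y, hy | hy⟩ := exists_isFence (x := fun i => f (φ.symm i))
    (hf.comp φ.symm.injective) (fun i => by
      have hadj : (SimpleGraph.pathGraph 6).Adj i.castSucc i.succ := by
        rw [SimpleGraph.pathGraph_adj]
        simp
      rcases (SimpleGraph.hasse_adj).1 (φ.symm.map_rel_iff.2 hadj) with h | h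
      · exact Or.inl (f.monotone.strictMono_of_injective hf h.lt)
      · exact Or.inr (f.monotone.strictMono_of_injective hf h.lt))
  · exact hF _ (by simp) (hasSubposet_W_of_isFence hy)
  · exact hF _ (by simp) (hasSubposet_M_of_isFence hy)

end Family

/-- The set `Fin k`, to be ordered as a path whose step from `i` to `i + 1` goes up if `up i` holds
and down otherwise. -/
def ZigZag (k : ℕ) (_up : ℕ → Prop) : Type := Fin k

namespace ZigZag

variable {k : ℕ} {up : ℕ → Prop}

/-- One element lies below another if all steps on the path between them go up, when read from the
first to the second. -/
instance : PartialOrder (ZigZag k up) where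
  le (i j : Fin k) := (i.val ≤ j.val ∧ ∀ t, i.val ≤ t → t < j.val → up t) ∨
    (j.val ≤ i.val ∧ ∀ t, j.val ≤ t → t < i.val → ¬ up t)
  le_refl i := Or.inl ⟨le_rfl, fun t h h' => absurd h' (by omega)⟩
  le_trans i j l hij hjl := by
    -- a rise followed by a fall, or a fall followed by a rise, is impossible: the step next to
    -- the middle element would go both up and down
    rcases hij with ⟨h, hu⟩ | ⟨h, hd⟩ <;> rcases hjl with ⟨h', hu'⟩ | ⟨h', hd'⟩
    · exact Or.inl ⟨h.trans h', fun t _ _ => if htj : t < Fin.val j then hu t ‹_› htj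
        else hu' t (by omega) ‹_›⟩
    · rcases h.eq_or_lt with h1 | h1
      · exact Or.inr ⟨h1 ▸ h', fun t _ _ => hd' t ‹_› (h1 ▸ ‹_›)⟩
      rcases h'.eq_or_lt with h2 | h2
      · exact Or.inl ⟨h2 ▸ h, fun t _ _ => hu t ‹_› (h2 ▸ ‹_›)⟩
      exact absurd (hu (Fin.val j - 1) (by omega) (by omega))
        (hd' (Fin.val j - 1) (by omega) (by omega))
    · rcases h.eq_or_lt with h1 | h1
      · exact Or.inl ⟨h1 ▸ h', fun t _ _ => hu' t (h1 ▸ ‹_›) ‹_›⟩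
      rcases h'.eq_or_lt with h2 | h2
      · exact Or.inr ⟨h2 ▸ h, fun t _ _ => hd t (h2 ▸ ‹_›) ‹_›⟩
      exact absurd (hu' (Fin.val j) le_rfl h2) (hd (Fin.val j) le_rfl h1)
    · exact Or.inr ⟨h'.trans h, fun t _ _ => if htj : t < Fin.val j then hd' t ‹_› htj
        else hd t (by omega) ‹_›⟩
  le_antisymm i j hij hji := by
    apply Fin.ext
    rcases hij with ⟨h, hu⟩ | ⟨h, hd⟩ <;> rcases hji with ⟨h', hu'⟩ | ⟨h', hd'⟩
    · omega
    · by_contra hne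
      exact hd' (Fin.val i) le_rfl (by omega) (hu (Fin.val i) le_rfl (by omega))
    · by_contra hne
      exact hd (Fin.val j) le_rfl (by omega) (hu' (Fin.val j) le_rfl (by omega))
    · omega

instance : Fintype (ZigZag k up) := inferInstanceAs (Fintype (Fin k))

theorem le_iff {i j : ZigZag k up} : i ≤ j ↔
    (Fin.val i ≤ Fin.val j ∧ ∀ t, Fin.val i ≤ t → t < Fin.val j → up t) ∨
      (Fin.val j ≤ Fin.val i ∧ ∀ t, Fin.val j ≤ t → t < Fin.val i → ¬ up t) :=
  Iff.rfl

theorem val_ne_of_lt {i j : ZigZag k up} (h : i < j) : Fin.val i ≠ Fin.val j :=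
  fun he => h.ne (Fin.ext he)

theorem adj_of_covBy {i j : ZigZag k up} (h : i ⋖ j) :
    Fin.val i + 1 = Fin.val j ∨ Fin.val j + 1 = Fin.val i := by
  have hne := val_ne_of_lt h.lt
  have hj := Fin.is_lt j
  have hi := Fin.is_lt i
  by_contra! hcon
  -- otherwise the neighbour of `i` on the path towards `j` lies strictly in between
  rcases le_iff.1 h.le with ⟨hij, hu⟩ | ⟨hij, hd⟩
  · let m : ZigZag k up := (⟨Fin.val i + 1, by omega⟩ : Fin k)
    refine h.2 (c := m) (lt_of_le_of_ne (le_iff.2 (Or.inl ⟨?_, fun t _ ht => hu t ‹_› ?_⟩))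
      fun he => ?_) (lt_of_le_of_ne (le_iff.2 (Or.inl ⟨?_, fun t ht _ => hu t ?_ ‹_›⟩))
      fun he => ?_)
    · show Fin.val i ≤ Fin.val i + 1; omega
    · have : t < Fin.val i + 1 := ht
      omega
    · have : Fin.val i = Fin.val i + 1 := congrArg Fin.val he
      omega
    · show Fin.val i + 1 ≤ Fin.val j; omega
    · have : Fin.val i + 1 ≤ t := ht
      omega
    · have : Fin.val i + 1 = Fin.val j := congrArg Fin.val he
      omega
  · let m : ZigZag k up := (⟨Fin.val i - 1, by omega⟩ : Fin k)
    refine h.2 (c := m) (lt_of_le_of_ne (le_iff.2 (Or.inr ⟨?_, fun t ht _ => hd t ?_ ‹_›⟩))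
      fun he => ?_) (lt_of_le_of_ne (le_iff.2 (Or.inr ⟨?_, fun t _ ht => hd t ‹_› ?_⟩))
      fun he => ?_)
    · show Fin.val i - 1 ≤ Fin.val i; omega
    · have : Fin.val i - 1 ≤ t := ht
      omega
    · have : Fin.val i = Fin.val i - 1 := congrArg Fin.val he
      omega
    · show Fin.val j ≤ Fin.val i - 1; omega
    · have : t < Fin.val i - 1 := ht
      omega
    · have : Fin.val i - 1 = Fin.val j := congrArg Fin.val he
      omega

theorem val_between {i c j : ZigZag k up} (hic : i < c) (hcj : c < j) :
    (Fin.val i < Fin.val c ∧ Fin.val c < Fin.val j) ∨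
      (Fin.val j < Fin.val c ∧ Fin.val c < Fin.val i) := by
  have h1 := val_ne_of_lt hic
  have h2 := val_ne_of_lt hcj
  rcases le_iff.1 hic.le with ⟨a, ha⟩ | ⟨a, ha⟩ <;>
    rcases le_iff.1 hcj.le with ⟨b, hb⟩ | ⟨b, hb⟩
  · omega
  · exact absurd (ha (Fin.val c - 1) (by omega) (by omega))
      (hb (Fin.val c - 1) (by omega) (by omega))
  · exact absurd (hb (Fin.val c) le_rfl (by omega)) (ha (Fin.val c) le_rfl (by omega))
  · omega

theorem covBy_or_covBy {i j : ZigZag k up} (h : Fin.val i + 1 = Fin.val j) :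
    i ⋖ j ∨ j ⋖ i := by
  have hne : i ≠ j := fun he => by
    have := congrArg Fin.val he
    omega
  by_cases hup : up (Fin.val i)
  · refine Or.inl ⟨lt_of_le_of_ne (le_iff.2 (Or.inl ⟨by omega, fun t _ _ => ?_⟩)) hne,
      fun c hic hcj => ?_⟩
    · rwa [show t = Fin.val i by omega]
    · have := val_between hic hcj
      omega
  · refine Or.inr ⟨lt_of_le_of_ne (le_iff.2 (Or.inr ⟨by omega, fun t _ _ => ?_⟩)) hne.symm,
      fun c hjc hci => ?_⟩
    · rwa [show t = Fin.val i by omega]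
    · have := val_between hjc hci
      omega

theorem mem_pathPosets (k : ℕ) (up : ℕ → Prop) :
    FinPartOrd.of (ZigZag k up) ∈ pathPosets k := by
  refine ⟨⟨Equiv.refl (Fin k), ?_⟩⟩
  intro i j
  refine SimpleGraph.pathGraph_adj.trans (Iff.trans ?_ SimpleGraph.hasse_adj.symm)
  exact ⟨fun h => h.elim covBy_or_covBy fun h => (covBy_or_covBy h).symm,
    fun h => h.elim adj_of_covBy fun h => (adj_of_covBy h).symm⟩

/-- A sequence that follows the steps of the path is order preserving. -/
theorem map_le {β : Type*} [Preorder β] {x : ℕ → β}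
    (hup : ∀ t, t + 1 < k → up t → x t ≤ x (t + 1))
    (hdown : ∀ t, t + 1 < k → ¬ up t → x (t + 1) ≤ x t) {i j : ZigZag k up} (h : i ≤ j) :
    x (Fin.val i) ≤ x (Fin.val j) := by
  have hi := Fin.is_lt i
  have hj := Fin.is_lt j
  rcases le_iff.1 h with ⟨hij, hu⟩ | ⟨hij, hd⟩
  · generalize Fin.val j = b at *
    induction b, hij using Nat.le_induction with
    | base => exact le_rfl
    | succ b hb ih =>
      exact (ih (by omega) fun t h h' => hu t h (by omega)).trans
        (hup b hj (hu b hb (by omega)))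
  · generalize Fin.val i = b at *
    induction b, hij using Nat.le_induction with
    | base => exact le_rfl
    | succ b hb ih =>
      exact (hdown b hi (hd b hb (by omega))).trans
        (ih (by omega) fun t h h' => hd t h (by omega))

end ZigZag

/-- A path on six vertices in the comparability graph of a family is the image of a poset whose
Hasse diagram is that path. -/
theorem noSixPath_of_isPosetFree {n : ℕ} {F : Finset (Finset (Fin n))}
    (hF : IsPosetFree F (pathPosets 6)) : NoSixPath SetComparable F := by
  rintro l ⟨hnd, hchain, hmem⟩ hlen
  let x : ℕ → Finset (Fin n) := fun t => l.getD t ∅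
  have hx : ∀ t (ht : t < 6), x t = l[t] := fun t ht => List.getD_eq_getElem _ _ _
  have hstep : ∀ t, t + 1 < 6 → SetComparable (x t) (x (t + 1)) := by
    intro t ht
    rw [hx t (by omega), hx (t + 1) ht]
    exact List.isChain_iff_getElem.1 hchain t (by omega)
  refine hF _ (ZigZag.mem_pathPosets 6 fun t => x t ⊆ x (t + 1)) ⟨⟨fun i => ⟨x (Fin.val i), ?_⟩,
    fun i j hij => ?_⟩, fun i j hij => ?_⟩
  · rw [hx _ (Fin.is_lt i)]
    exact hmem _ (List.getElem_mem _)
  · exact ZigZag.map_le (fun t _ h => h)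
      (fun t ht h => ((hstep t ht).resolve_left fun h' => h h'.subset).subset) hij
  · have hij : x (Fin.val i) = x (Fin.val j) := congrArg Subtype.val hij
    rw [hx _ (Fin.is_lt i), hx _ (Fin.is_lt j)] at hij
    exact Fin.ext ((hnd.getElem_inj_iff).1 hij)

/-! ### Copies of the two-element chain -/

section Copies

variable {n : ℕ}

theorem isCopy_chainPoset_two_iff {G : Finset (Finset (Fin n))} :
    IsCopy G (chainPoset 2) ↔ ∃ A B, A ⊂ B ∧ G = {A, B} := by
  constructor
  · rintro ⟨f, hf⟩
    refine ⟨(f (0 : Fin 2)).1, (f (1 : Fin 2)).1, ?_, ?_⟩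
    · exact f.monotone.strictMono_of_injective hf.1 (show (0 : Fin 2) < 1 by decide)
    · ext A
      rw [mem_insert, mem_singleton]
      constructor
      · intro hA
        obtain ⟨i, hi⟩ := hf.2 ⟨A, hA⟩
        have key : ∀ i : Fin 2, (f i).1 = A → A = (f (0 : Fin 2)).1 ∨ A = (f (1 : Fin 2)).1 := by
          intro i h
          fin_cases i
          exacts [Or.inl h.symm, Or.inr h.symm]
        exact key i (congrArg Subtype.val hi)
      · rintro (rfl | rfl)
        exacts [Subtype.property _, Subtype.property _]
  · rintro ⟨A, B, hAB, rfl⟩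
    refine ⟨⟨fun i : Fin 2 => if i = 0 then ⟨A, by simp⟩ else ⟨B, by simp⟩, ?_⟩, ?_, ?_⟩
    · show ∀ i j : Fin 2, _
      intro i j hij
      fin_cases i <;> fin_cases j
      · exact le_rfl
      · exact hAB.subset
      · exact absurd hij (by decide)
      · exact le_rfl
    · show ∀ i j : Fin 2, _
      intro i j hij
      fin_cases i <;> fin_cases j
      · rfl
      · exact absurd (congrArg Subtype.val hij) hAB.ne
      · exact absurd (congrArg Subtype.val hij) hAB.ne'
      · rfl
    · rintro ⟨C, hC⟩
      rw [mem_insert, mem_singleton] at hC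
      rcases hC with rfl | rfl
      exacts [⟨(0 : Fin 2), rfl⟩, ⟨(1 : Fin 2), rfl⟩]

theorem numCopies_chainPoset_two (F : Finset (Finset (Fin n))) :
    numCopies F (chainPoset 2) = #{p ∈ F ×ˢ F | p.1 ⊂ p.2} := by
  classical
  rw [numCopies]
  symm
  refine card_bij (fun p _ => {p.1, p.2}) ?_ ?_ ?_
  · rintro ⟨A, B⟩ h
    simp only [mem_filter, mem_product, mem_powerset] at h ⊢
    exact ⟨by simp [insert_subset_iff, h.1], isCopy_chainPoset_two_iff.2 ⟨A, B, h.2, rfl⟩⟩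
  · rintro ⟨A, B⟩ h ⟨C, D⟩ h' he
    simp only [mem_filter] at h h'
    have hA : A ∈ ({C, D} : Finset _) := he ▸ mem_insert_self _ _
    have hB : B ∈ ({C, D} : Finset _) := he ▸ (by simp)
    rw [mem_insert, mem_singleton] at hA hB
    rcases hA with rfl | rfl <;> rcases hB with rfl | rfl
    · exact absurd rfl h.2.ne
    · rfl
    · exact absurd h.2 h'.2.asymm
    · exact absurd rfl h.2.ne
  · intro G hG
    rw [mem_filter, mem_powerset] at hG
    obtain ⟨A, B, hAB, rfl⟩ := isCopy_chainPoset_two_iff.1 hG.2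
    refine ⟨(A, B), ?_, rfl⟩
    simp only [insert_subset_iff, singleton_subset_iff] at hG
    simp [hG.1, hAB]

theorem numCopies_le_two_mul_card {F : Finset (Finset (Fin n))}
    (hF : IsPosetFree F (pathPosets 6)) : numCopies F (chainPoset 2) ≤ 2 * #F := by
  have h := (noSixPath_of_isPosetFree hF).sum_degree_le SetComparable.symm SetComparable.irrefl
  have h2 := sum_setComparable F (fun _ _ => 1) fun _ _ => rfl
  simp only [sum_const, smul_eq_mul, mul_one] at h2
  rw [numCopies_chainPoset_two]
  have h3 : 2 * #{p ∈ F ×ˢ F | p.1 ⊂ p.2} ≤ 4 * #F := h2 ▸ h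
  exact Nat.le_of_mul_le_mul_left (h3.trans_eq (by ring)) two_pos

theorem numCopies_le_La {F : Finset (Finset (Fin n))} {Ps : Set FinPartOrd.{0}}
    (hF : IsPosetFree F Ps) (Q : FinPartOrd.{0}) : numCopies F Q ≤ La n Ps Q := by
  classical
  exact le_sup (f := fun F => numCopies F Q) (mem_filter.2 ⟨mem_univ F, hF⟩)

theorem La_le {Ps : Set FinPartOrd.{0}} {Q : FinPartOrd.{0}} {N : ℕ}
    (h : ∀ F : Finset (Finset (Fin n)), IsPosetFree F Ps → numCopies F Q ≤ N) :
    La n Ps Q ≤ N := by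
  classical
  exact Finset.sup_le fun F hF => h F (mem_filter.1 hF).2

end Copies

/-! ### The family consisting of the middle level, the empty set and the whole set -/

/-- The sets of size `⌊n / 2⌋` together with `∅` and `[n]`. -/
def middleFamily (n : ℕ) : Finset (Finset (Fin n)) :=
  insert ∅ (insert univ (powersetCard (n / 2) univ))

theorem mem_middleFamily {n : ℕ} {A : Finset (Fin n)} :
    A ∈ middleFamily n ↔ A = ∅ ∨ A = univ ∨ #A = n / 2 := by
  simp [middleFamily, mem_powersetCard]

theorem eq_empty_of_ssubset_of_ssubset {n : ℕ} {A B C : Finset (Fin n)} (hA : A ∈ middleFamily n)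
    (hB : B ∈ middleFamily n) (hC : C ∈ middleFamily n) (hAB : A ⊂ B) (hAC : A ⊂ C) (hBC : B ≠ C) :
    A = ∅ := by
  have key : ∀ D ∈ middleFamily n, A ⊂ D → #A = n / 2 → D = univ := by
    intro D hD hAD hA
    have := card_lt_card hAD
    rcases mem_middleFamily.1 hD with rfl | h | h
    · simp at this
    · exact h
    · omega
  rcases mem_middleFamily.1 hA with h | rfl | h
  · exact h
  · exact absurd (subset_univ B) hAB.2
  · exact absurd ((key B hB hAB h).trans (key C hC hAC h).symm) hBC

theorem eq_univ_of_ssubset_of_ssubset {n : ℕ} {A B C : Finset (Fin n)} (hA : A ∈ middleFamily n)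
    (hB : B ∈ middleFamily n) (hC : C ∈ middleFamily n) (hBA : B ⊂ A) (hCA : C ⊂ A) (hBC : B ≠ C) :
    A = univ := by
  have key : ∀ D ∈ middleFamily n, D ⊂ A → #A = n / 2 → D = ∅ := by
    intro D hD hDA hA
    have := card_lt_card hDA
    rcases mem_middleFamily.1 hD with h | rfl | h
    · exact h
    · exact absurd (subset_univ A) hDA.2
    · omega
  rcases mem_middleFamily.1 hA with rfl | h | h
  · exact absurd (empty_subset B) hBA.2
  · exact h
  · exact absurd ((key B hB hBA h).trans (key C hC hCA h).symm) hBC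

/-- Two elements of `W` have two upper bounds each, and two elements of `M` two lower bounds each,
but in the family only `∅` and the whole set, respectively, have so many. -/
theorem isPosetFree_middleFamily (n : ℕ) : IsPosetFree (middleFamily n) {posetW, posetM} := by
  rintro P (rfl | rfl) ⟨f, hf⟩
  · have hlt : ∀ u v : WElem, WElem.Le u v → u ≠ v → (f u).1 ⊂ (f v).1 := fun u v h hne =>
      f.monotone.strictMono_of_injective hf (lt_of_le_of_ne (show u ≤ v from h) hne)
    have hne : ∀ u v : WElem, u ≠ v → (f u).1 ≠ (f v).1 := fun u v h he =>
      h (hf (Subtype.ext he))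
    have hb := eq_empty_of_ssubset_of_ssubset (f WElem.b).2 (f WElem.a).2 (f WElem.c).2
      (hlt _ _ .ba nofun) (hlt _ _ .bc nofun) (hne _ _ nofun)
    have hd := eq_empty_of_ssubset_of_ssubset (f WElem.d).2 (f WElem.c).2 (f WElem.e).2
      (hlt _ _ .dc nofun) (hlt _ _ .de nofun) (hne _ _ nofun)
    exact hne .b .d nofun (hb.trans hd.symm)
  · let g : WElem → {A : Finset (Fin n) // A ∈ middleFamily n} := fun u => f (OrderDual.toDual u)
    have hg : Function.Injective g := hf.comp OrderDual.toDual.injective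
    have hlt : ∀ u v : WElem, WElem.Le u v → u ≠ v → (g v).1 ⊂ (g u).1 := fun u v h hne =>
      lt_of_le_of_ne (f.monotone (show OrderDual.toDual v ≤ OrderDual.toDual u from h))
        fun he => hne (hg (Subtype.ext he.symm))
    have hne : ∀ u v : WElem, u ≠ v → (g u).1 ≠ (g v).1 := fun u v h he =>
      h (hg (Subtype.ext he))
    have hb := eq_univ_of_ssubset_of_ssubset (g WElem.b).2 (g WElem.a).2 (g WElem.c).2
      (hlt _ _ .ba nofun) (hlt _ _ .bc nofun) (hne _ _ nofun)
    have hd := eq_univ_of_ssubset_of_ssubset (g WElem.d).2 (g WElem.c).2 (g WElem.e).2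
      (hlt _ _ .dc nofun) (hlt _ _ .de nofun) (hne _ _ nofun)
    exact hne .b .d nofun (hb.trans hd.symm)

theorem le_numCopies_middleFamily {n : ℕ} (hn : 2 ≤ n) :
    2 * n.choose (n / 2) + 1 ≤ numCopies (middleFamily n) (chainPoset 2) := by
  let L : Finset (Finset (Fin n)) := powersetCard (n / 2) univ
  have hL : #L = n.choose (n / 2) := by simp [L]
  have hcard : ∀ A ∈ L, #A = n / 2 := fun A hA => (mem_powersetCard.1 hA).2
  have h0 : ∅ ∉ L := fun h => by
    have := hcard _ h
    simp at this
    omega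
  have h1 : univ ∉ L := fun h => by
    have := hcard _ h
    simp at this
    omega
  have hempty : ∀ A : Finset (Fin n), A ≠ ∅ → ∅ ⊂ A := fun A h =>
    (empty_subset A).ssubset_of_ne h.symm
  have huniv : ∀ A : Finset (Fin n), A ≠ univ → A ⊂ univ := fun A h =>
    (subset_univ A).ssubset_of_ne h
  have hne : (∅ : Finset (Fin n)) ≠ univ := fun h => by
    have := congrArg card h
    simp at this
    omega
  have hpairs : ({∅} ×ˢ insert univ L) ∪ L ×ˢ {univ} ⊆
      {p ∈ middleFamily n ×ˢ middleFamily n | p.1 ⊂ p.2} := by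
    rintro ⟨A, B⟩ h
    simp only [mem_union, mem_product, mem_singleton, mem_insert, mem_filter,
      mem_middleFamily] at h ⊢
    rcases h with ⟨rfl, rfl | hB⟩ | ⟨hA, rfl⟩
    · exact ⟨by simp, hempty _ hne.symm⟩
    · exact ⟨by simp [hcard B hB], hempty _ fun h => h0 (h ▸ hB)⟩
    · exact ⟨by simp [hcard A hA], huniv _ fun h => h1 (h ▸ hA)⟩
  have hdisj : Disjoint (({∅} : Finset (Finset (Fin n))) ×ˢ insert univ L) (L ×ˢ {univ}) := by
    rw [disjoint_product]
    exact Or.inl (by simpa using h0)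
  have := card_le_card hpairs
  rw [card_union_of_disjoint hdisj, card_product, card_product, card_insert_of_notMem h1,
    hL] at this
  rw [numCopies_chainPoset_two]
  simp only [card_singleton] at this
  omega

/-! ### Asymptotics -/

/-- There are at most `2 m n ^ m` sets that have fewer than `m` elements or lack fewer than `m`. -/
theorem card_filter_extreme_le {n : ℕ} (hn : 0 < n) (m : ℕ) (F : Finset (Finset (Fin n))) :
    #{A ∈ F | ¬ (m ≤ #A ∧ m + #A ≤ n)} ≤ 2 * (m * n ^ m) := by
  have hsmall : #{A : Finset (Fin n) | #A < m} ≤ m * n ^ m := by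
    have hsub : ({A : Finset (Fin n) | #A < m} : Finset _) ⊆
        (range m).biUnion fun k => powersetCard k univ := by
      intro A hA
      simp only [mem_filter, mem_univ, true_and] at hA
      simp only [mem_biUnion, mem_range, mem_powersetCard]
      exact ⟨#A, hA, subset_univ A, rfl⟩
    refine (card_le_card hsub).trans ((card_biUnion_le_card_mul _ _ (n ^ m) fun k hk => ?_).trans
      (by rw [card_range]))
    rw [card_powersetCard, card_univ, Fintype.card_fin]
    exact (Nat.choose_le_pow n k).trans (Nat.pow_le_pow_right hn (mem_range.1 hk).le)
  have hsub : {A ∈ F | ¬ (m ≤ #A ∧ m + #A ≤ n)} ⊆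
      ({A : Finset (Fin n) | #A < m} : Finset _) ∪
        ({A : Finset (Fin n) | #A < m} : Finset _).image compl := by
    intro A hA
    simp only [mem_filter, mem_union, mem_image, mem_univ, true_and] at hA ⊢
    by_cases h : #A < m
    · exact Or.inl h
    · refine Or.inr ⟨Aᶜ, ?_, compl_compl A⟩
      have := card_le_univ A
      rw [card_compl]
      simp only [Fintype.card_fin] at this ⊢
      omega
  refine (card_le_card hsub).trans ((card_union_le _ _).trans ?_)
  have := card_image_le (s := ({A : Finset (Fin n) | #A < m} : Finset _)) (f := compl)
  omega

/-- The bound on the sets of size between `k + 4` and `n - (k + 4)`, together with the bound on the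
number of the remaining sets. -/
theorem mul_La_le {n : ℕ} (hn : 0 < n) (k : ℕ) :
    k * La n (pathPosets 6) (chainPoset 2) ≤
      2 * ((k + 4) * n.choose (n / 2)) + 4 * (k * ((k + 4) * n ^ (k + 4))) := by
  rcases k.eq_zero_or_pos with rfl | hk
  · simp
  rw [mul_comm, ← Nat.le_div_iff_mul_le hk]
  refine La_le fun F hF => ?_
  rw [Nat.le_div_iff_mul_le hk]
  let p : Finset (Fin n) → Prop := fun A => k + 4 ≤ #A ∧ k + 4 + #A ≤ n
  have hmid := card_mul_le_of_noSixPath (F.filter p)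
    ((noSixPath_of_isPosetFree hF).mono (filter_subset _ _)) (m := k + 4) (by omega)
    (fun A hA => (mem_filter.1 hA).2.1) (fun A hA => by simpa using (mem_filter.1 hA).2.2)
  rw [Fintype.card_fin] at hmid
  have hext : k * #{A ∈ F | ¬ p A} ≤ k * (2 * ((k + 4) * n ^ (k + 4))) :=
    Nat.mul_le_mul_left k (card_filter_extreme_le hn (k + 4) F)
  have hsplit := card_filter_add_card_filter_not (s := F) p
  have hedges := Nat.mul_le_mul_right k (numCopies_le_two_mul_card hF)
  rw [← hsplit] at hedges
  nlinarith

theorem two_pow_le_succ_mul_choose (n : ℕ) : 2 ^ n ≤ (n + 1) * n.choose (n / 2) := by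
  rw [← Nat.sum_range_choose, ← smul_eq_mul]
  exact (sum_le_card_nsmul _ _ _ fun k _ => Nat.choose_le_middle k n).trans (by simp)

theorem tendsto_pow_div_choose (k : ℕ) :
    Filter.Tendsto (fun n : ℕ => (n : ℝ) ^ k / (n.choose (n / 2) : ℝ)) Filter.atTop (nhds 0) := by
  have h := (tendsto_pow_const_div_const_pow_of_one_lt (k + 1) (r := (2 : ℝ))
    (by norm_num)).const_mul 2
  rw [mul_zero] at h
  refine squeeze_zero' (.of_forall fun n => by positivity) ?_ h
  filter_upwards [Filter.eventually_ge_atTop 1] with n hn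
  have hC : (0 : ℝ) < n.choose (n / 2) := by
    exact_mod_cast Nat.choose_pos (Nat.div_le_self n 2)
  have hn' : (1 : ℝ) ≤ n := by exact_mod_cast hn
  have h2 : (2 : ℝ) ^ n ≤ (n + 1) * n.choose (n / 2) := by
    exact_mod_cast two_pow_le_succ_mul_choose n
  rw [← mul_div_assoc, div_le_div_iff₀ hC (by positivity)]
  calc (n : ℝ) ^ k * 2 ^ n ≤ n ^ k * ((n + 1) * n.choose (n / 2)) := by gcongr
    _ ≤ n ^ k * ((n + n) * n.choose (n / 2)) := by gcongr
    _ = 2 * n ^ (k + 1) * n.choose (n / 2) := by ring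

theorem eventually_La_le {δ : ℝ} (hδ : 0 < δ) :
    ∀ᶠ n : ℕ in Filter.atTop, (La n (pathPosets 6) (chainPoset 2) : ℝ) ≤
      (2 + δ) * (n.choose (n / 2) : ℝ) := by
  -- sizes are restricted to `[k + 4, n - k - 4]`; then `2 (k + 4) / k = 2 + 8 / k < 2 + δ / 2`
  obtain ⟨k, hk⟩ := exists_nat_gt (16 / δ)
  have hk0 : (0 : ℝ) < k := lt_trans (by positivity) hk
  rw [div_lt_iff₀ hδ] at hk
  have hlim := (tendsto_pow_div_choose (k + 4)).const_mul (4 * ((k : ℝ) + 4))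
  rw [mul_zero] at hlim
  filter_upwards [hlim.eventually (gt_mem_nhds (half_pos hδ)), Filter.eventually_ge_atTop 1]
    with n hn hn1
  have hC : (0 : ℝ) < n.choose (n / 2) := by
    exact_mod_cast Nat.choose_pos (Nat.div_le_self n 2)
  have hLa : (k : ℝ) * La n (pathPosets 6) (chainPoset 2) ≤
      2 * ((k + 4) * n.choose (n / 2)) + 4 * (k * ((k + 4) * (n : ℝ) ^ (k + 4))) := by
    exact_mod_cast mul_La_le hn1 k
  rw [← mul_div_assoc, div_lt_iff₀ hC] at hn
  generalize (n.choose (n / 2) : ℝ) = C at *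
  generalize (n : ℝ) ^ (k + 4) = N at *
  refine le_of_mul_le_mul_left (hLa.trans ?_) hk0
  have h1 : (k : ℝ) * (4 * (k + 4) * N) ≤ k * (δ / 2 * C) :=
    mul_le_mul_of_nonneg_left hn.le hk0.le
  have h2 : 16 * C ≤ k * δ * C := mul_le_mul_of_nonneg_right hk.le hC.le
  linarith

theorem theorem1p7 :
    ∃ ε : ℕ → ℝ, Filter.Tendsto ε Filter.atTop (nhds 0) ∧
      ∀ n : ℕ, 2 ≤ n →
        2 * n.choose (n / 2) + 1 ≤ La n {posetW, posetM} (chainPoset 2) ∧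
        La n {posetW, posetM} (chainPoset 2) ≤ La n (pathPosets 6) (chainPoset 2) ∧
        (La n (pathPosets 6) (chainPoset 2) : ℝ) ≤ (2 + ε n) * (n.choose (n / 2) : ℝ) := by
  have hC : ∀ n : ℕ, (0 : ℝ) < n.choose (n / 2) := fun n => by
    exact_mod_cast Nat.choose_pos (Nat.div_le_self n 2)
  refine ⟨fun n => max 0 ((La n (pathPosets 6) (chainPoset 2) : ℝ) / n.choose (n / 2) - 2),
    ?_, fun n hn => ⟨?_, ?_, ?_⟩⟩
  · refine tendsto_order.2 ⟨fun a ha => .of_forall fun n => ha.trans_le (le_max_left _ _),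
      fun a ha => ?_⟩
    filter_upwards [eventually_La_le (half_pos ha)] with n hn
    refine max_lt ha ?_
    rw [← div_le_iff₀ (hC n)] at hn
    linarith
  · exact (le_numCopies_middleFamily hn).trans (numCopies_le_La (isPosetFree_middleFamily n) _)
  · exact La_le fun F hF => numCopies_le_La (isPosetFree_pathPosets_of_isPosetFree_W_M hF) _
  · rw [← div_le_iff₀ (hC n)]
    linarith [le_max_right 0 ((La n (pathPosets 6) (chainPoset 2) : ℝ) / n.choose (n / 2) - 2)]
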